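/- Let $\mathbb{Q}$ denote the quaternions, let $c,\eta,\mu>0$ be real numbers, and let $\Phi_{c,\eta}:\mathbb{R}\to\mathbb{R}$ be the minimax concave penalty (MCP), i.e. the even function with $$\Phi_{c,\eta}(x)=\begin{cases} cx-\dfrac{x^2}{2\eta}, & 0\le x\le c\eta,\\[1ex] \dfrac{c^2\eta}{2}, & x>c\eta.\end{cases}$$ For $L\in\mathbb{Q}^{n_1\times n_2}$ let $\sigma_1(L)\ge\dots\ge\sigma_{n_{(2)}}(L)\ge 0$, $n_{(2)}=\min\{n_1,n_2\}$, be its singular values, and put $\|L\|_{\mathrm{MCP}}=\sum_{i=1}^{n_{(2)}}\Phi_{c,\eta}(\sigma_i(L))$. For $f:\mathbb{R}\to\mathbb{R}$ let $\mathrm{Prox}_f(y)$ be the set of all global minimizers over $x\in\mathbb{R}$ of $f(x)+\frac12|x-y|^2$. Theorem (quaternion thresholding operator for the MCP penalty). Let $Y\in\mathbb{Q}^{n_1\times n_2}$ have the quaternion singular value decomposition $Y=U\Sigma V^*$, where $U\in\mathbb{Q}^{n_1\times n_1}$ and $V\in\mathbb{Q}^{n_2\times n_2}$ are unitary and $\Sigma\in\mathbb{R}^{n_1\times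 n_2}$ is the rectangular diagonal matrix with diagonal entries $s_1,\dots,s_{n_{(2)}}\ge 0$. Then each set $\mathrm{Prox}_{\frac1\mu\Phi_{c,\eta}}(s_i)$ is nonempty, and for every choice of $p_i\in\mathrm{Prox}_{\frac1\mu\Phi_{c,\eta}}(s_i)$, $i=1,\dots,n_{(2)}$, the matrix $$L_\clubsuit=U\,\mathrm{Diag}(p_1,\dots,p_{n_{(2)}})\,V^*,$$ where $\mathrm{Diag}(p_1,\dots,p_{n_{(2)}})$ is the $n_1\times n_2$ rectangular diagonal matrix, is an optimal solution of $$\min_{L\in\mathbb{Q}^{n_1\times n_2}}\ \frac1\mu\|L\|_{\mathrm{MCP}}+\frac12\|L-Y\|_F^2 .$$ -/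

import Mathlib

open scoped Quaternion Matrix

attribute [local instance] Matrix.frobeniusNormedAddCommGroup

noncomputable section

namespace QuaternionMatrix

/-- The `m × n` matrix with the real numbers `s 0, s 1, …` at the positions `(0, 0), (1, 1), …`
and zeros elsewhere. -/
def rectDiag {m n : ℕ} (s : Fin (min m n) → ℝ) : Matrix (Fin m) (Fin n) ℍ[ℝ] :=
  Matrix.of fun i j =>
    if h : (i : ℕ) = (j : ℕ) then ((s ⟨i, lt_min i.2 (h ▸ j.2)⟩ : ℝ) : ℍ[ℝ]) else 0

/-- `X = U Σ Vᴴ` is a singular value decomposition of the quaternion matrix `X`: the square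
quaternion matrices `U` and `V` are unitary, and `Σ` is the rectangular diagonal matrix with the
nonnegative real diagonal entries `s`. -/
structure IsQSVD {m n : ℕ} (X : Matrix (Fin m) (Fin n) ℍ[ℝ]) (U : Matrix (Fin m) (Fin m) ℍ[ℝ])
    (s : Fin (min m n) → ℝ) (V : Matrix (Fin n) (Fin n) ℍ[ℝ]) : Prop where
  left_unitary : Uᴴ * U = 1 ∧ U * Uᴴ = 1
  right_unitary : Vᴴ * V = 1 ∧ V * Vᴴ = 1
  nonneg : ∀ i, 0 ≤ s i
  eq : X = U * rectDiag s * Vᴴ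

/-! ### Existence of a decomposition with decreasing diagonal entries -/

/-- Squared Euclidean norm of a quaternion vector. -/
def vsq {n : ℕ} (x : Fin n → ℍ[ℝ]) : ℝ := ∑ i, ‖x i‖ ^ 2

theorem star_mul_self_eq (a : ℍ[ℝ]) : star a * a = ((‖a‖ ^ 2 : ℝ) : ℍ[ℝ]) := by
  rw [Quaternion.star_mul_self, Quaternion.normSq_eq_norm_mul_self, sq]

theorem self_mul_star_eq (a : ℍ[ℝ]) : a * star a = ((‖a‖ ^ 2 : ℝ) : ℍ[ℝ]) := by
  rw [Quaternion.self_mul_star, Quaternion.normSq_eq_norm_mul_self, sq]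

theorem vsq_nonneg {n : ℕ} (x : Fin n → ℍ[ℝ]) : 0 ≤ vsq x :=
  Finset.sum_nonneg fun _ _ => by positivity

theorem eq_zero_of_vsq {n : ℕ} {x : Fin n → ℍ[ℝ]} (h : vsq x = 0) : x = 0 := by
  funext i
  have := (Finset.sum_eq_zero_iff_of_nonneg (fun i _ => by positivity)).1 h i (Finset.mem_univ i)
  simpa using this

theorem star_dotProduct_self {n : ℕ} (x : Fin n → ℍ[ℝ]) :
    star x ⬝ᵥ x = ((vsq x : ℝ) : ℍ[ℝ]) := by
  simp only [dotProduct, vsq, Pi.star_apply, star_mul_self_eq]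
  exact (map_sum (algebraMap ℝ ℍ[ℝ]) _ _).symm

theorem vsq_mulVec {m n : ℕ} {U : Matrix (Fin m) (Fin n) ℍ[ℝ]} (hU : Uᴴ * U = 1)
    (x : Fin n → ℍ[ℝ]) : vsq (U *ᵥ x) = vsq x := by
  have h : star (U *ᵥ x) ⬝ᵥ (U *ᵥ x) = star x ⬝ᵥ x := by
    rw [Matrix.star_mulVec, ← Matrix.dotProduct_mulVec, Matrix.mulVec_mulVec, hU,
      Matrix.one_mulVec]
  rw [star_dotProduct_self, star_dotProduct_self] at h
  exact Quaternion.coe_injective h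

theorem vsq_smul {n : ℕ} (r : ℝ) (x : Fin n → ℍ[ℝ]) : vsq (r • x) = r ^ 2 * vsq x := by
  simp [vsq, norm_smul, mul_pow, Finset.mul_sum]

/-- Quaternion Householder reflection. -/
theorem exists_unitary_col {n : ℕ} (x : Fin (n + 1) → ℍ[ℝ]) (hx : vsq x = 1) :
    ∃ U : Matrix (Fin (n + 1)) (Fin (n + 1)) ℍ[ℝ], (Uᴴ * U = 1 ∧ U * Uᴴ = 1) ∧
      U *ᵥ Pi.single 0 1 = x := by
  obtain ⟨q, hq, hqx⟩ : ∃ q : ℍ[ℝ], ‖q‖ = 1 ∧ star (x 0) * q = ((‖x 0‖ : ℝ) : ℍ[ℝ]) := by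
    by_cases h0 : x 0 = 0
    · exact ⟨1, by simp, by simp [h0]⟩
    · have h1 : ‖x 0‖ ≠ 0 := by simpa using h0
      refine ⟨‖x 0‖⁻¹ • x 0, by simp [norm_smul, h1], ?_⟩
      rw [mul_smul_comm, star_mul_self_eq, ← Quaternion.coe_smul, smul_eq_mul]
      congr 1
      field_simp
  set e : Fin (n + 1) → ℍ[ℝ] := Pi.single 0 q with he
  set w : Fin (n + 1) → ℍ[ℝ] := e - x with hw
  have hwe : star w ⬝ᵥ e = ((1 - ‖x 0‖ : ℝ) : ℍ[ℝ]) := by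
    rw [he, dotProduct_single]
    simp only [hw, he, Pi.star_apply, Pi.sub_apply, Pi.single_eq_same, star_sub, sub_mul,
      star_mul_self_eq, hq, hqx]
    simp
  have hxe : vsq w = 2 * (1 - ‖x 0‖) := by
    have h1 : ‖q - x 0‖ ^ 2 = (1 - ‖x 0‖) ^ 2 := by
      have : ‖star q * (q - x 0)‖ = |1 - ‖x 0‖| := by
        have hs : star q * x 0 = ((‖x 0‖ : ℝ) : ℍ[ℝ]) := by
          have := congrArg star hqx
          simpa using this
        rw [mul_sub, star_mul_self_eq, hq, hs, ← Quaternion.coe_sub, Quaternion.norm_coe]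
        simp
      rw [norm_mul, norm_star, hq, one_mul] at this
      rw [this, sq_abs]
    have h2 : ∀ i : Fin n, ‖w i.succ‖ ^ 2 = ‖x i.succ‖ ^ 2 := by
      intro i
      simp [hw, he]
    have h3 : vsq w = ‖q - x 0‖ ^ 2 + ∑ i : Fin n, ‖x i.succ‖ ^ 2 := by
      rw [vsq, Fin.sum_univ_succ]
      simp only [h2]
      simp [hw, he]
    have h4 : vsq x = ‖x 0‖ ^ 2 + ∑ i : Fin n, ‖x i.succ‖ ^ 2 := by
      rw [vsq, Fin.sum_univ_succ]
    rw [h3, h1]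
    nlinarith
  set t : ℝ := 2 / vsq w with ht
  set P : Matrix (Fin (n + 1)) (Fin (n + 1)) ℍ[ℝ] := Matrix.vecMulVec w (star w) with hP
  have hPh : Pᴴ = P := by
    rw [hP, Matrix.conjTranspose_vecMulVec, star_star]
  have hPP : P * P = vsq w • P := by
    rw [hP, Matrix.vecMulVec_mul_vecMulVec, star_dotProduct_self]
    ext1 i j
    simp [Matrix.vecMulVec_apply, Quaternion.coe_mul_eq_smul]
  set H : Matrix (Fin (n + 1)) (Fin (n + 1)) ℍ[ℝ] := 1 - t • P with hH
  have hHh : Hᴴ = H := by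
    rw [hH, Matrix.conjTranspose_sub, Matrix.conjTranspose_one]
    congr 1
    ext1 i j
    have h : star (P j i) = P i j := congrFun (congrFun hPh i) j
    simp [Quaternion.star_smul, h]
  have hHH : H * H = 1 := by
    have : t * t * vsq w = 2 * t := by
      by_cases h : vsq w = 0
      · simp [ht, h]
      · rw [ht]; field_simp
    rw [hH, sub_mul, mul_sub, mul_sub, smul_mul_smul_comm, hPP, smul_smul, this]
    simp only [mul_one, one_mul, two_mul, add_smul]
    abel
  have hHe : H *ᵥ e = x := by
    have h1 : P *ᵥ e = (1 - ‖x 0‖) • w := by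
      rw [hP, Matrix.vecMulVec_mulVec, hwe]
      funext i
      simp [← Quaternion.mul_coe_eq_smul]
    rw [hH, Matrix.sub_mulVec, Matrix.one_mulVec, Matrix.smul_mulVec, h1, smul_smul]
    by_cases h : vsq w = 0
    · have h2 : w = 0 := eq_zero_of_vsq h
      rw [h2, smul_zero, sub_zero]
      exact sub_eq_zero.1 h2
    · have h2 : t * (1 - ‖x 0‖) = 1 := by
        rw [ht, div_mul_eq_mul_div, ← hxe, div_self h]
      rw [h2, one_smul, hw, sub_sub_cancel]
  set D : Matrix (Fin (n + 1)) (Fin (n + 1)) ℍ[ℝ] :=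
    Matrix.diagonal (Function.update 1 0 q) with hD
  have hDD : Dᴴ * D = 1 ∧ D * Dᴴ = 1 := by
    rw [hD, Matrix.diagonal_conjTranspose, Matrix.diagonal_mul_diagonal,
      Matrix.diagonal_mul_diagonal, ← Matrix.diagonal_one]
    constructor
    · congr 1
      funext i
      by_cases hi : i = 0
      · subst hi; simp [star_mul_self_eq, hq]
      · simp [hi]
    · congr 1
      funext i
      by_cases hi : i = 0
      · subst hi; simp [self_mul_star_eq, hq]
      · simp [hi]
  refine ⟨H * D, ⟨?_, ?_⟩, ?_⟩
  · rw [Matrix.conjTranspose_mul, hHh, Matrix.mul_assoc, ← Matrix.mul_assoc H, hHH,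
      Matrix.one_mul, hDD.1]
  · rw [Matrix.conjTranspose_mul, hHh, Matrix.mul_assoc, ← Matrix.mul_assoc D, hDD.2,
      Matrix.one_mul, hHH]
  · rw [← Matrix.mulVec_mulVec, ← hHe]
    congr 1
    funext i
    rw [hD, Matrix.mulVec_diagonal]
    by_cases hi : i = 0
    · subst hi; simp [he]
    · simp [hi, he]

theorem exists_max {m n : ℕ} (A : Matrix (Fin m) (Fin (n + 1)) ℍ[ℝ]) :
    ∃ v, vsq v = 1 ∧ ∀ x, vsq (A *ᵥ x) ≤ vsq (A *ᵥ v) * vsq x := by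
  have : ProperSpace ℍ[ℝ] := FiniteDimensional.proper_real _
  have hc : ∀ k : ℕ, Continuous (vsq : (Fin k → ℍ[ℝ]) → ℝ) := fun k => by
    unfold vsq; fun_prop
  have hK : IsCompact {v : Fin (n + 1) → ℍ[ℝ] | vsq v = 1} := by
    refine Metric.isCompact_of_isClosed_isBounded (isClosed_eq (hc _) continuous_const) ?_
    refine (Metric.isBounded_closedBall (x := 0) (r := 1)).subset fun v hv => ?_
    rw [mem_closedBall_zero_iff, pi_norm_le_iff_of_nonneg zero_le_one]
    intro i
    have h1 : ‖v i‖ ^ 2 ≤ vsq v :=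
      Finset.single_le_sum (f := fun i => ‖v i‖ ^ 2) (fun i _ => by positivity) (Finset.mem_univ i)
    change vsq v = 1 at hv
    rw [hv] at h1
    nlinarith [norm_nonneg (v i)]
  have hne : {v : Fin (n + 1) → ℍ[ℝ] | vsq v = 1}.Nonempty := by
    refine ⟨Pi.single 0 1, ?_⟩
    simp [vsq, Fin.sum_univ_succ]
  have hcA : Continuous fun x : Fin (n + 1) → ℍ[ℝ] => A *ᵥ x := by
    refine continuous_pi fun i => ?_
    simp only [Matrix.mulVec, dotProduct]
    fun_prop
  obtain ⟨v, hv, hmax⟩ := hK.exists_isMaxOn hne ((hc m).comp hcA).continuousOn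
  refine ⟨v, hv, fun x => ?_⟩
  by_cases h : vsq x = 0
  · rw [eq_zero_of_vsq h]
    simp [vsq]
  · have hpos : 0 < vsq x := lt_of_le_of_ne (vsq_nonneg x) (Ne.symm h)
    have h1 : vsq ((√(vsq x))⁻¹ • x) = 1 := by
      rw [vsq_smul, inv_pow, Real.sq_sqrt hpos.le, inv_mul_cancel₀ h]
    have h2 : vsq (A *ᵥ ((√(vsq x))⁻¹ • x)) ≤ vsq (A *ᵥ v) := hmax h1
    rw [Matrix.mulVec_smul, vsq_smul, inv_pow, Real.sq_sqrt hpos.le, inv_mul_le_iff₀ hpos] at h2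
    linarith

/-- The block diagonal matrix with blocks `a` (of size one) and `M`. -/
def blk {m n : ℕ} (a : ℍ[ℝ]) (M : Matrix (Fin m) (Fin n) ℍ[ℝ]) :
    Matrix (Fin (m + 1)) (Fin (n + 1)) ℍ[ℝ] :=
  Matrix.of fun i j =>
    Fin.cases (Fin.cases a (fun _ => 0) j) (fun i' => Fin.cases 0 (fun j' => M i' j') j) i

theorem blk_mul {l m n : ℕ} (a b : ℍ[ℝ]) (M : Matrix (Fin l) (Fin m) ℍ[ℝ])
    (N : Matrix (Fin m) (Fin n) ℍ[ℝ]) : blk a M * blk b N = blk (a * b) (M * N) := by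
  ext1 i j
  refine Fin.cases ?_ (fun i => ?_) i <;> refine Fin.cases ?_ (fun j => ?_) j <;>
    simp [blk, Matrix.mul_apply, Fin.sum_univ_succ]

theorem blk_conjTranspose {m n : ℕ} (a : ℍ[ℝ]) (M : Matrix (Fin m) (Fin n) ℍ[ℝ]) :
    (blk a M)ᴴ = blk (star a) Mᴴ := by
  ext1 i j
  refine Fin.cases ?_ (fun i => ?_) i <;> refine Fin.cases ?_ (fun j => ?_) j <;>
    simp [blk]

theorem blk_one {m : ℕ} : blk 1 (1 : Matrix (Fin m) (Fin m) ℍ[ℝ]) = 1 := by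
  ext1 i j
  refine Fin.cases ?_ (fun i => ?_) i <;> refine Fin.cases ?_ (fun j => ?_) j <;>
    simp [blk, Matrix.one_apply, Fin.succ_ne_zero, Ne.symm (Fin.succ_ne_zero _)]

theorem exists_decomp (m : ℕ) : ∀ (n : ℕ) (A : Matrix (Fin m) (Fin n) ℍ[ℝ]),
    ∃ (U : Matrix (Fin m) (Fin m) ℍ[ℝ]) (s : ℕ → ℝ) (V : Matrix (Fin n) (Fin n) ℍ[ℝ]),
      (Uᴴ * U = 1 ∧ U * Uᴴ = 1) ∧ (Vᴴ * V = 1 ∧ V * Vᴴ = 1) ∧ Antitone s ∧ (∀ i, 0 ≤ s i) ∧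
      (∀ C : ℝ, 0 ≤ C → (∀ x, vsq (A *ᵥ x) ≤ C ^ 2 * vsq x) → ∀ i, s i ≤ C) ∧
      A = U * rectDiag (fun i : Fin (min m n) => s i) * Vᴴ := by
  induction m with
  | zero =>
    intro n A
    refine ⟨1, 0, 1, by simp, by simp, fun _ _ _ => le_rfl, fun _ => le_rfl,
      fun C hC _ _ => hC, ?_⟩
    ext1 i j
    exact i.elim0
  | succ m ih =>
    intro n A
    cases n with
    | zero =>
      refine ⟨1, 0, 1, by simp, by simp, fun _ _ _ => le_rfl, fun _ => le_rfl,
        fun C hC _ _ => hC, ?_⟩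
      ext1 i j
      exact j.elim0
    | succ n =>
      obtain ⟨v, hv, hmax⟩ := exists_max A
      set σ : ℝ := √(vsq (A *ᵥ v)) with hσ
      have hσ0 : 0 ≤ σ := Real.sqrt_nonneg _
      have hσ2 : σ ^ 2 = vsq (A *ᵥ v) := Real.sq_sqrt (vsq_nonneg _)
      obtain ⟨V, hV, hVv⟩ := exists_unitary_col v hv
      obtain ⟨U, hU, hUu⟩ : ∃ U : Matrix (Fin (m + 1)) (Fin (m + 1)) ℍ[ℝ],
          (Uᴴ * U = 1 ∧ U * Uᴴ = 1) ∧ U *ᵥ (σ • Pi.single 0 1) = A *ᵥ v := by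
        by_cases h : σ = 0
        · refine ⟨1, by simp, ?_⟩
          rw [h, zero_smul, Matrix.mulVec_zero]
          rw [h] at hσ2
          exact (eq_zero_of_vsq (by linarith)).symm
        · have h1 : vsq (σ⁻¹ • (A *ᵥ v)) = 1 := by
            rw [vsq_smul, ← hσ2]
            field_simp
          obtain ⟨U, hU, hUu⟩ := exists_unitary_col _ h1
          refine ⟨U, hU, ?_⟩
          rw [Matrix.mulVec_smul, hUu, smul_smul, mul_inv_cancel₀ h, one_smul]
      set B := Uᴴ * A * V with hB
      have hBle : ∀ x, vsq (B *ᵥ x) ≤ σ ^ 2 * vsq x := by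
        intro x
        rw [hB, ← Matrix.mulVec_mulVec, ← Matrix.mulVec_mulVec,
          vsq_mulVec (U := Uᴴ) (by simpa using hU.2), hσ2]
        refine (hmax _).trans_eq ?_
        rw [vsq_mulVec hV.1]
      have hcol : B *ᵥ Pi.single 0 1 = σ • Pi.single 0 1 := by
        rw [hB, ← Matrix.mulVec_mulVec, ← Matrix.mulVec_mulVec, hVv, ← hUu,
          Matrix.mulVec_mulVec, hU.1, Matrix.one_mulVec]
      have hB00 : B 0 0 = ((σ : ℝ) : ℍ[ℝ]) := by
        have := congrFun hcol 0
        simpa [← Quaternion.coe_mul_eq_smul] using this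
      have hBi0 : ∀ i : Fin m, B i.succ 0 = 0 := by
        intro i
        have := congrFun hcol i.succ
        simpa using this
      have hB0j : ∀ j : Fin n, B 0 j.succ = 0 := by
        set x : Fin (n + 1) → ℍ[ℝ] := fun j => star (B 0 j) with hx
        have h1 : (B *ᵥ x) 0 = ((vsq x : ℝ) : ℍ[ℝ]) := by
          rw [← star_dotProduct_self]
          simp [Matrix.mulVec, dotProduct, hx]
        have h2 : ‖(B *ᵥ x) 0‖ ^ 2 ≤ vsq (B *ᵥ x) :=
          Finset.single_le_sum (f := fun i => ‖(B *ᵥ x) i‖ ^ 2) (fun i _ => by positivity)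
            (Finset.mem_univ 0)
        rw [h1, Quaternion.norm_coe, Real.norm_eq_abs, sq_abs] at h2
        have h3 := h2.trans (hBle x)
        have h4 : vsq x = σ ^ 2 + vsq (fun j : Fin n => x j.succ) := by
          rw [vsq, Fin.sum_univ_succ, vsq]
          simp [hx, hB00, Quaternion.norm_coe]
        have h5 : vsq (fun j : Fin n => x j.succ) = 0 := by
          have h6 := vsq_nonneg (fun j : Fin n => x j.succ)
          rw [h4] at h3
          nlinarith [sq_nonneg σ, mul_nonneg (sq_nonneg σ) h6]
        intro j
        have := congrFun (eq_zero_of_vsq h5) j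
        simpa [hx] using this
      set B' : Matrix (Fin m) (Fin n) ℍ[ℝ] := Matrix.of fun i j => B i.succ j.succ with hB'
      have hBblk : B = blk ((σ : ℝ) : ℍ[ℝ]) B' := by
        ext1 i j
        refine Fin.cases ?_ (fun i => ?_) i <;> refine Fin.cases ?_ (fun j => ?_) j <;>
          simp [blk, hB00, hBi0, hB0j, hB']
      obtain ⟨U', s, V', hU', hV', hs, hs0, hsC, hdec⟩ := ih n B'
      have hsσ : ∀ i, s i ≤ σ := by
        refine hsC σ hσ0 fun x => ?_
        have h1 := hBle (Fin.cons 0 x)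
        have h2 : vsq (Fin.cons 0 x : Fin (n + 1) → ℍ[ℝ]) = vsq x := by
          simp [vsq, Fin.sum_univ_succ]
        have h3 : vsq (B *ᵥ Fin.cons 0 x) = vsq (B' *ᵥ x) := by
          rw [vsq, Fin.sum_univ_succ, vsq]
          simp [Matrix.mulVec, dotProduct, Fin.sum_univ_succ, hB0j, hB']
        rwa [h2, h3] at h1
      have hblku : ∀ {k : ℕ} {W : Matrix (Fin k) (Fin k) ℍ[ℝ]}, (Wᴴ * W = 1 ∧ W * Wᴴ = 1) →
          ((blk 1 W)ᴴ * blk 1 W = 1 ∧ blk 1 W * (blk 1 W)ᴴ = 1) := by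
        intro k W hW
        rw [blk_conjTranspose, blk_mul, blk_mul, hW.1, hW.2]
        simp [blk_one]
      have hmulu : ∀ {k : ℕ} {W Z : Matrix (Fin k) (Fin k) ℍ[ℝ]},
          (Wᴴ * W = 1 ∧ W * Wᴴ = 1) → (Zᴴ * Z = 1 ∧ Z * Zᴴ = 1) →
          ((W * Z)ᴴ * (W * Z) = 1 ∧ (W * Z) * (W * Z)ᴴ = 1) := by
        intro k W Z hW hZ
        rw [Matrix.conjTranspose_mul]
        constructor
        · rw [Matrix.mul_assoc, ← Matrix.mul_assoc Wᴴ, hW.1, Matrix.one_mul, hZ.1]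
        · rw [Matrix.mul_assoc, ← Matrix.mul_assoc Z, hZ.2, Matrix.one_mul, hW.2]
      set s' : ℕ → ℝ := fun k => Nat.casesOn k σ s with hs'
      refine ⟨U * blk 1 U', s', V * blk 1 V', hmulu hU (hblku hU'), hmulu hV (hblku hV'),
        ?_, ?_, ?_, ?_⟩
      · refine antitone_nat_of_succ_le fun k => ?_
        cases k with
        | zero => exact hsσ 0
        | succ k => exact hs (Nat.le_succ k)
      · intro k
        cases k with
        | zero => exact hσ0
        | succ k => exact hs0 k
      · intro C hC hbound k
        have h1 : σ ≤ C := by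
          have := hbound v
          rw [← hσ2, hv, mul_one] at this
          exact (sq_le_sq₀ hσ0 hC).1 this
        cases k with
        | zero => exact h1
        | succ k => exact (hsσ k).trans h1
      · have hdiag : (rectDiag (fun i : Fin (min (m + 1) (n + 1)) => s' i) : Matrix (Fin (m + 1)) (Fin (n + 1)) ℍ[ℝ]) =
            blk ((σ : ℝ) : ℍ[ℝ]) (rectDiag (fun i : Fin (min m n) => s i)) := by
          ext1 i j
          refine Fin.cases ?_ (fun i => ?_) i <;> refine Fin.cases ?_ (fun j => ?_) j <;>
            simp [blk, rectDiag, hs']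
        have h1 : A = U * B * Vᴴ := by
          rw [hB, Matrix.mul_assoc, Matrix.mul_assoc (Uᴴ * A), hV.2, Matrix.mul_one,
            ← Matrix.mul_assoc, hU.2, Matrix.one_mul]
        have h2 : B = blk 1 U' * blk ((σ : ℝ) : ℍ[ℝ]) (rectDiag (fun i : Fin (min m n) => s i)) *
            (blk 1 V')ᴴ := by
          rw [blk_conjTranspose, blk_mul, blk_mul, ← hdec, hBblk]
          simp
        rw [hdiag, Matrix.conjTranspose_mul]
        conv_lhs => rw [h1, h2]
        simp only [Matrix.mul_assoc]

theorem exists_antitone_qsvd {m n : ℕ} (X : Matrix (Fin m) (Fin n) ℍ[ℝ]) :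
    ∃ s : Fin (min m n) → ℝ, Antitone s ∧ ∃ U V, IsQSVD X U s V := by
  obtain ⟨U, s, V, hU, hV, hs, hs0, -, hdec⟩ := exists_decomp m n X
  exact ⟨fun i => s i, fun i j hij => hs hij, U, V, hU, hV, fun i => hs0 i, hdec⟩

/-! ### Singular values, the penalty, and the proximal mapping -/

/-- The singular values `σ₁(X) ≥ σ₂(X) ≥ ⋯` of a quaternion matrix, counted with multiplicity:
the diagonal of a singular value decomposition whose diagonal entries decrease. -/
def singularValues {m n : ℕ} (X : Matrix (Fin m) (Fin n) ℍ[ℝ]) : Fin (min m n) → ℝ :=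
  (exists_antitone_qsvd X).choose

theorem singularValues_spec {m n : ℕ} (X : Matrix (Fin m) (Fin n) ℍ[ℝ]) :
    Antitone (singularValues X) ∧ ∃ U V, IsQSVD X U (singularValues X) V :=
  (exists_antitone_qsvd X).choose_spec

/-- The minimax concave penalty (MCP) function with parameters `c` and `η`, extended from
`[0, ∞)` to an even function on `ℝ`. -/
def mcp (c η x : ℝ) : ℝ :=
  if |x| ≤ c * η then c * |x| - 1 / (2 * η) * x ^ 2 else c ^ 2 * η / 2

/-- The MCP surrogate of the rank: the sum of the penalty over all singular values. -/
def mcpNorm (c η : ℝ) {m n : ℕ} (X : Matrix (Fin m) (Fin n) ℍ[ℝ]) : ℝ :=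
  ∑ i, mcp c η (singularValues X i)

/-- The (set-valued) proximal mapping of `f` at `y`: all global minimizers of
`x ↦ f x + ‖x - y‖² / 2`. -/
def prox {E : Type*} [NormedAddCommGroup E] (f : E → ℝ) (y : E) : Set E :=
  {x | IsMinOn (fun z => f z + 1 / 2 * ‖z - y‖ ^ 2) Set.univ x}

end QuaternionMatrix

end

namespace QuaternionMatrix

/-! ### The penalty function -/

/-! The matrix problem is bounded below by the sum of the scalar problems, and the thresholded
matrix attains the bound. Let L = A diag(t) Bᴴ be a singular value decomposition and put P = UᴴA, Q
= VᴴB. By unitary invariance, ‖L − Y‖² is the sum of the terms |P_ij t_j − s_i Q_ij|². The reverse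
triangle inequality and 2|P_ij||Q_ij| ≤ |P_ij|² + |Q_ij|² give ‖L − Y‖² ≥ ∑ t_j² + ∑ s_i² − 2 ∑ D_ij
s_i t_j, where D is the average of the arrays |P_ij|² and |Q_ij|², truncated to m × n
(`exists_substochastic`). Only the row and column sums of D matter, so neither s nor t need be
ordered. Write f = Φ/μ, k(x) = f(x) + x²/2 and h_i = min_x (k(x) − s_i x), attained at p_i. Then h_i
≤ k(t_j) − s_i t_j for all i, j. Averaging with the weights D_ij gives ∑ h_i ≤ ∑ k(t_j) − ∑ D_ij s_i
t_j; since h_i ≤ 0 ≤ k, row and column sums at most 1 suffice (`sum_le_of_substochastic`). Adding ∑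
s_i²/2 bounds the objective below. At the thresholded matrix equality holds because its MCP value is
∑ Φ(p_i). This needs the diagonal of a decomposition to be unique up to order and sign
(`sum_eq_sum_of_decomp`). -/

theorem mcp_zero {c η : ℝ} (hc : 0 < c) (hη : 0 < η) : mcp c η 0 = 0 := by
  have : 0 ≤ c * η := by positivity
  simp [mcp, this]

theorem mcp_congr {c η x y : ℝ} (h : x ^ 2 = y ^ 2) : mcp c η x = mcp c η y := by
  have h' : |x| = |y| := (sq_eq_sq_iff_abs_eq_abs x y).1 h
  rw [mcp, mcp, h, h']

theorem mcp_nonneg {c η : ℝ} (hc : 0 < c) (hη : 0 < η) (x : ℝ) : 0 ≤ mcp c η x := by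
  unfold mcp
  split_ifs with h
  · have h1 : c * |x| - 1 / (2 * η) * x ^ 2 = |x| / (2 * η) * (2 * (c * η) - |x|) := by
      rw [← sq_abs x]
      field_simp
    have h2 : 0 ≤ c * η := by positivity
    rw [h1]
    exact mul_nonneg (by positivity) (by linarith)
  · positivity

theorem continuous_mcp {c η : ℝ} (hη : 0 < η) : Continuous (mcp c η) := by
  unfold mcp
  refine Continuous.if_le (by fun_prop) (by fun_prop) (by fun_prop) (by fun_prop) fun x hx => ?_
  -- At the breakpoint |x| = cη both branches equal c²η/2.
  rw [← sq_abs x, hx]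
  field_simp
  ring

/-- The objective dominates its quadratic term, hence is coercive, and a continuous coercive
function attains its minimum. -/
theorem prox_nonempty {f : ℝ → ℝ} (hf : Continuous f) (hf0 : ∀ x, 0 ≤ f x) (y : ℝ) :
    (prox f y).Nonempty := by
  have hlim : Filter.Tendsto (fun z => f z + 1 / 2 * ‖z - y‖ ^ 2) (Filter.cocompact ℝ)
      Filter.atTop := by
    refine Filter.tendsto_atTop_mono (f := fun z => 1 / 2 * ‖z - y‖ ^ 2)
      (fun z => by linarith [hf0 z]) ?_
    refine Filter.Tendsto.const_mul_atTop (by norm_num) ?_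
    refine (Filter.tendsto_pow_atTop two_ne_zero).comp ?_
    exact (tendsto_norm_cocompact_atTop (E := ℝ)).comp
      (Homeomorph.subRight y).isClosedEmbedding.tendsto_cocompact
  obtain ⟨x, hx⟩ := Continuous.exists_forall_le (by fun_prop) hlim
  exact ⟨x, fun z _ => hx z⟩

/-! ### Padding finite sequences by zero -/

/-- The extension of a finite sequence by zero. -/
def pad {R : Type*} [Zero R] {k : ℕ} (f : Fin k → R) (i : ℕ) : R :=
  if h : i < k then f ⟨i, h⟩ else 0

section pad

variable {R : Type*} [Zero R] {k : ℕ}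

theorem pad_of_lt (f : Fin k → R) {i : ℕ} (h : i < k) : pad f i = f ⟨i, h⟩ := dif_pos h

theorem pad_of_le (f : Fin k → R) {i : ℕ} (h : k ≤ i) : pad f i = 0 := dif_neg (not_lt.2 h)

theorem pad_val (f : Fin k → R) (i : Fin k) : pad f i = f i := pad_of_lt f i.2

theorem pad_nonneg {f : Fin k → ℝ} (hf : ∀ i, 0 ≤ f i) (i : ℕ) : 0 ≤ pad f i := by
  unfold pad
  split_ifs
  exacts [hf _, le_rfl]

theorem sum_comp_pad_range (f : Fin k → R) {g : R → ℝ} (hg : g 0 = 0) {N : ℕ} (hN : k ≤ N) :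
    ∑ i ∈ Finset.range N, g (pad f i) = ∑ i, g (f i) := by
  rw [← Finset.sum_subset (Finset.range_mono hN) fun i _ hi => by
      rw [pad_of_le f (by simpa using hi), hg],
    Finset.sum_range]
  simp only [pad_val]

theorem sum_comp_pad (f : Fin k → R) {g : R → ℝ} (hg : g 0 = 0) {N : ℕ} (hN : k ≤ N) :
    ∑ i : Fin N, g (pad f i) = ∑ i, g (f i) := by
  rw [← sum_comp_pad_range f hg hN, Finset.sum_range]

theorem sum_pad_le {f : Fin k → ℝ} (hf : ∀ i, 0 ≤ f i) (N : ℕ) :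
    ∑ i : Fin N, pad f i ≤ ∑ i, f i := by
  -- Since N may lie on either side of k, the full sum is written over `range (max k N)`, which
  -- contains `range N`.
  rw [← sum_comp_pad_range f (g := fun x => x) rfl (le_max_left k N), ← Finset.sum_range (pad f)]
  exact Finset.sum_le_sum_of_subset_of_nonneg (Finset.range_mono (le_max_right k N))
    fun i _ _ => pad_nonneg hf i

end pad

/-! ### Rectangular diagonal matrices -/

section rectDiag

variable {m n : ℕ}

theorem rectDiag_apply (s : Fin (min m n) → ℝ) (i : Fin m) (j : Fin n) :
    (rectDiag s : Matrix (Fin m) (Fin n) ℍ[ℝ]) i j =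
      if (i : ℕ) = j then ((pad s i : ℝ) : ℍ[ℝ]) else 0 := by
  simp only [rectDiag, Matrix.of_apply]
  split_ifs with h
  · rw [pad_of_lt]
  · rfl

/-- Padding the row of P as well gives one formula for all columns, including those beyond the
square part, where both sides vanish. -/
theorem mul_rectDiag_apply (P : Matrix (Fin m) (Fin m) ℍ[ℝ]) (t : Fin (min m n) → ℝ) (i : Fin m)
    (j : Fin n) : (P * rectDiag t) i j = pad (P i) j * ((pad t j : ℝ) : ℍ[ℝ]) := by
  rw [Matrix.mul_apply]
  simp only [rectDiag_apply]
  by_cases h : (j : ℕ) < m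
  · rw [Finset.sum_eq_single ⟨j, h⟩, pad_of_lt _ h]
    · simp
    · intro x _ hx
      rw [if_neg fun h' => hx (Fin.ext h'), mul_zero]
    · simp
  · rw [pad_of_le (P i) (not_lt.1 h), zero_mul]
    refine Finset.sum_eq_zero fun x _ => ?_
    rw [if_neg fun h' => h (by omega), mul_zero]

theorem rectDiag_mul_apply (s : Fin (min m n) → ℝ) (Q : Matrix (Fin n) (Fin n) ℍ[ℝ]) (i : Fin m)
    (j : Fin n) : (rectDiag s * Q) i j = ((pad s i : ℝ) : ℍ[ℝ]) * pad (fun k => Q k j) i := by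
  rw [Matrix.mul_apply]
  simp only [rectDiag_apply]
  by_cases h : (i : ℕ) < n
  · rw [Finset.sum_eq_single ⟨i, h⟩, pad_of_lt _ h]
    · simp
    · intro x _ hx
      rw [if_neg fun h' => hx (Fin.ext h'.symm), zero_mul]
    · simp
  · rw [pad_of_le _ (not_lt.1 h), mul_zero]
    refine Finset.sum_eq_zero fun x _ => ?_
    rw [if_neg fun h' => h (by omega), zero_mul]

theorem rectDiag_mul_conjTranspose (s : Fin (min m n) → ℝ) :
    (rectDiag s : Matrix (Fin m) (Fin n) ℍ[ℝ]) * (rectDiag s)ᴴ =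
      Matrix.diagonal fun i : Fin m => ((pad s i ^ 2 : ℝ) : ℍ[ℝ]) := by
  ext1 i j
  rw [Matrix.mul_apply, Matrix.diagonal_apply]
  simp only [rectDiag_apply, Matrix.conjTranspose_apply]
  by_cases h : (i : ℕ) < n
  · rw [Finset.sum_eq_single ⟨i, h⟩]
    · by_cases hij : i = j
      · subst hij
        simp [sq]
      · rw [if_neg hij, if_neg (c := (j : ℕ) = _) fun h' => hij (Fin.ext h'.symm), star_zero,
          mul_zero]
    · intro x _ hx
      rw [if_neg fun h' => hx (Fin.ext h'.symm), zero_mul]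
    · simp
  · rw [pad_of_le s (by omega)]
    simp only [Quaternion.coe_zero, ite_self, zero_mul, Finset.sum_const_zero]
    simp

end rectDiag

/-! ### The Frobenius norm and unitary matrices -/

theorem frobenius_norm_sq {m n : ℕ} (M : Matrix (Fin m) (Fin n) ℍ[ℝ]) :
    ‖M‖ ^ 2 = ∑ i, ∑ j, ‖M i j‖ ^ 2 := by
  rw [Matrix.frobenius_norm_def, ← Real.sqrt_eq_rpow, Real.sq_sqrt]
  · simp
  · positivity

theorem frobenius_norm_sq_mul_left {l m n : ℕ} {U : Matrix (Fin l) (Fin m) ℍ[ℝ]}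
    (hU : Uᴴ * U = 1) (M : Matrix (Fin m) (Fin n) ℍ[ℝ]) : ‖U * M‖ ^ 2 = ‖M‖ ^ 2 := by
  rw [frobenius_norm_sq, frobenius_norm_sq, Finset.sum_comm, Finset.sum_comm (γ := Fin m)]
  exact Finset.sum_congr rfl fun j _ => vsq_mulVec hU fun i => M i j

theorem frobenius_norm_sq_mul_right {l m n : ℕ} {V : Matrix (Fin m) (Fin n) ℍ[ℝ]}
    (hV : V * Vᴴ = 1) (M : Matrix (Fin l) (Fin m) ℍ[ℝ]) : ‖M * V‖ ^ 2 = ‖M‖ ^ 2 := by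
  rw [← Matrix.frobenius_norm_conjTranspose, Matrix.conjTranspose_mul,
    frobenius_norm_sq_mul_left (by simpa using hV), Matrix.frobenius_norm_conjTranspose]

theorem sum_col_norm_sq {m n : ℕ} {P : Matrix (Fin m) (Fin n) ℍ[ℝ]} (hP : Pᴴ * P = 1)
    (j : Fin n) : ∑ i, ‖P i j‖ ^ 2 = 1 := by
  -- The j-th column is the image of a unit basis vector under an isometry.
  have h := vsq_mulVec hP (Pi.single j 1)
  have h1 : vsq (Pi.single j 1 : Fin n → ℍ[ℝ]) = 1 := by
    rw [vsq, Finset.sum_eq_single j]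
    · simp
    · intro i _ hi
      simp [hi]
    · simp
  rw [h1] at h
  simpa [vsq] using h

theorem sum_row_norm_sq {m n : ℕ} {P : Matrix (Fin m) (Fin n) ℍ[ℝ]} (hP : P * Pᴴ = 1)
    (i : Fin m) : ∑ j, ‖P i j‖ ^ 2 = 1 := by
  simpa using sum_col_norm_sq (P := Pᴴ) (by simpa using hP) i

theorem unitary_conjTranspose_mul {k : ℕ} {U A : Matrix (Fin k) (Fin k) ℍ[ℝ]}
    (hU : Uᴴ * U = 1 ∧ U * Uᴴ = 1) (hA : Aᴴ * A = 1 ∧ A * Aᴴ = 1) :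
    (Uᴴ * A)ᴴ * (Uᴴ * A) = 1 ∧ (Uᴴ * A) * (Uᴴ * A)ᴴ = 1 := by
  rw [Matrix.conjTranspose_mul, Matrix.conjTranspose_conjTranspose]
  constructor
  · rw [Matrix.mul_assoc, ← Matrix.mul_assoc U, hU.2, Matrix.one_mul, hA.1]
  · rw [Matrix.mul_assoc, ← Matrix.mul_assoc A, hA.2, Matrix.one_mul, hU.1]

/-! ### Two decompositions of one matrix -/

section

variable {m n : ℕ}

theorem conjTranspose_mul_sub_mul {U A : Matrix (Fin m) (Fin m) ℍ[ℝ]}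
    {V B : Matrix (Fin n) (Fin n) ℍ[ℝ]} (hU : Uᴴ * U = 1) (hB : Bᴴ * B = 1)
    (T S : Matrix (Fin m) (Fin n) ℍ[ℝ]) :
    Uᴴ * (A * T * Bᴴ - U * S * Vᴴ) * B = Uᴴ * A * T - S * (Vᴴ * B) := by
  rw [Matrix.mul_sub, Matrix.sub_mul]
  congr 1
  · simp only [Matrix.mul_assoc, hB, Matrix.mul_one]
  · simp only [← Matrix.mul_assoc, hU, Matrix.one_mul]

/-- Up to order and sign, the diagonal of a decomposition is determined by the matrix. -/
theorem sum_eq_sum_of_decomp {U A : Matrix (Fin m) (Fin m) ℍ[ℝ]}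
    {V B : Matrix (Fin n) (Fin n) ℍ[ℝ]} (hU : Uᴴ * U = 1 ∧ U * Uᴴ = 1)
    (hV : Vᴴ * V = 1 ∧ V * Vᴴ = 1) (hA : Aᴴ * A = 1 ∧ A * Aᴴ = 1)
    (hB : Bᴴ * B = 1 ∧ B * Bᴴ = 1) {p t : Fin (min m n) → ℝ}
    (h : A * rectDiag t * Bᴴ = U * rectDiag p * Vᴴ) {g : ℝ → ℝ} (hg0 : g 0 = 0)
    (hg : ∀ x y, x ^ 2 = y ^ 2 → g x = g y) : ∑ i, g (t i) = ∑ i, g (p i) := by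
  set P := Uᴴ * A with hPdef
  set Q := Vᴴ * B with hQdef
  have hP := unitary_conjTranspose_mul hU hA
  have hQ := unitary_conjTranspose_mul hV hB
  rw [← hPdef] at hP
  rw [← hQdef] at hQ
  have h1 : P * rectDiag t = rectDiag p * Q := by
    have := conjTranspose_mul_sub_mul hU.1 hB.1 (V := V) (A := A) (rectDiag t) (rectDiag p)
    rw [h, sub_self, Matrix.mul_zero, Matrix.zero_mul] at this
    exact (sub_eq_zero.1 this.symm)
  -- Multiplying each side of `h1` by its own adjoint eliminates Q: P intertwines the two diagonal
  -- matrices of squares.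
  have h2 : P * (rectDiag t * (rectDiag t)ᴴ) = rectDiag p * (rectDiag p)ᴴ * P := by
    have h3 := congrArg (fun M => M * Mᴴ * P) h1
    simp only [Matrix.conjTranspose_mul] at h3
    calc P * (rectDiag t * (rectDiag t)ᴴ)
        = P * rectDiag t * ((rectDiag t)ᴴ * Pᴴ) * P := by
          simp only [Matrix.mul_assoc, hP.1, Matrix.mul_one]
      _ = rectDiag p * Q * (Qᴴ * (rectDiag p)ᴴ) * P := h3
      _ = rectDiag p * (Q * Qᴴ) * (rectDiag p)ᴴ * P := by simp only [Matrix.mul_assoc]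
      _ = _ := by rw [hQ.2, Matrix.mul_one]
  rw [rectDiag_mul_conjTranspose, rectDiag_mul_conjTranspose] at h2
  -- Real scalars are central, so a nonzero P_ij cancels and forces t_j² = p_i². Since the |P_ij|²
  -- are doubly stochastic, summing these identities over i and j compares the two sums of g.
  have h3 : ∀ i j, ‖P i j‖ ^ 2 * g (pad t j) = ‖P i j‖ ^ 2 * g (pad p i) := by
    intro i j
    have h4 := congrFun (congrFun h2 i) j
    rw [Matrix.mul_diagonal, Matrix.diagonal_mul, ← Quaternion.coe_commutes] at h4
    by_cases h0 : P i j = 0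
    · simp [h0]
    · rw [hg _ _ (Quaternion.coe_injective (mul_right_cancel₀ h0 h4))]
  calc ∑ i, g (t i) = ∑ j : Fin m, g (pad t j) := (sum_comp_pad t hg0 (min_le_left m n)).symm
    _ = ∑ j : Fin m, ∑ i, ‖P i j‖ ^ 2 * g (pad t j) := by
      simp only [← Finset.sum_mul, sum_col_norm_sq hP.1, one_mul]
    _ = ∑ i : Fin m, ∑ j, ‖P i j‖ ^ 2 * g (pad p i) := by
      rw [Finset.sum_comm]
      simp only [h3]
    _ = ∑ i : Fin m, g (pad p i) := by
      simp only [← Finset.sum_mul, sum_row_norm_sq hP.2, one_mul]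
    _ = ∑ i, g (p i) := sum_comp_pad p hg0 (min_le_left m n)

/-- Since the penalty is even, p may be unordered and of any sign, so proximal points need not be
shown nonnegative. -/
theorem mcpNorm_mul_rectDiag_mul {c η : ℝ} (hc : 0 < c) (hη : 0 < η)
    {U : Matrix (Fin m) (Fin m) ℍ[ℝ]} {V : Matrix (Fin n) (Fin n) ℍ[ℝ]}
    (hU : Uᴴ * U = 1 ∧ U * Uᴴ = 1) (hV : Vᴴ * V = 1 ∧ V * Vᴴ = 1) (p : Fin (min m n) → ℝ) :
    mcpNorm c η (U * rectDiag p * Vᴴ) = ∑ i, mcp c η (p i) := by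
  obtain ⟨-, A, B, h⟩ := singularValues_spec (U * rectDiag p * Vᴴ)
  exact sum_eq_sum_of_decomp hU hV h.left_unitary h.right_unitary h.eq.symm (mcp_zero hc hη)
    fun x y => mcp_congr

theorem frobenius_norm_sq_rectDiag (p : Fin (min m n) → ℝ) :
    ‖(rectDiag p : Matrix (Fin m) (Fin n) ℍ[ℝ])‖ ^ 2 = ∑ i, p i ^ 2 := by
  rw [← sum_comp_pad p (g := fun x => x ^ 2) (by simp) (min_le_left m n), frobenius_norm_sq]
  refine Finset.sum_congr rfl fun i _ => ?_
  simp only [rectDiag_apply]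
  by_cases h : (i : ℕ) < n
  · rw [Finset.sum_eq_single ⟨i, h⟩]
    · simp [Quaternion.norm_coe]
    · intro x _ hx
      rw [if_neg fun h' => hx (Fin.ext h'.symm)]
      simp
    · simp
  · rw [pad_of_le p (by omega)]
    simp

/-! ### Substochastic coupling and the separable lower bound -/

theorem norm_sq_mul_coe_sub_le {a b : ℍ[ℝ]} {t s : ℝ} (ht : 0 ≤ t) (hs : 0 ≤ s) :
    t ^ 2 * ‖a‖ ^ 2 + s ^ 2 * ‖b‖ ^ 2 - s * t * (‖a‖ ^ 2 + ‖b‖ ^ 2) ≤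
      ‖a * (t : ℍ[ℝ]) - (s : ℍ[ℝ]) * b‖ ^ 2 := by
  have h := abs_norm_sub_norm_le (a * (t : ℍ[ℝ])) ((s : ℍ[ℝ]) * b)
  rw [norm_mul, norm_mul, Quaternion.norm_coe, Quaternion.norm_coe, Real.norm_of_nonneg ht,
    Real.norm_of_nonneg hs] at h
  have h1 := pow_le_pow_left₀ (abs_nonneg _) h 2
  rw [sq_abs] at h1
  -- The cross term 2st‖a‖‖b‖ is at most st(‖a‖² + ‖b‖²).
  nlinarith [mul_nonneg (mul_nonneg hs ht) (sq_nonneg (‖a‖ - ‖b‖))]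

theorem pad_norm_sq {k : ℕ} (f : Fin k → ℍ[ℝ]) (i : ℕ) :
    pad (fun j => ‖f j‖ ^ 2) i = ‖pad f i‖ ^ 2 := by
  unfold pad
  split_ifs <;> simp

theorem sum_pad_norm_sq_le {k : ℕ} (f : Fin k → ℍ[ℝ]) (N : ℕ) :
    ∑ i : Fin N, ‖pad f i‖ ^ 2 ≤ ∑ i, ‖f i‖ ^ 2 := by
  simp only [← pad_norm_sq]
  exact sum_pad_le (fun i => by positivity) N

/-- A form of the von Neumann trace inequality: the inner product of two matrices is bounded
through a doubly substochastic coupling of their singular values. -/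
theorem exists_substochastic {U A : Matrix (Fin m) (Fin m) ℍ[ℝ]}
    {V B : Matrix (Fin n) (Fin n) ℍ[ℝ]} (hU : Uᴴ * U = 1 ∧ U * Uᴴ = 1)
    (hV : Vᴴ * V = 1 ∧ V * Vᴴ = 1) (hA : Aᴴ * A = 1 ∧ A * Aᴴ = 1)
    (hB : Bᴴ * B = 1 ∧ B * Bᴴ = 1) {s t : Fin (min m n) → ℝ} (hs : ∀ i, 0 ≤ s i)
    (ht : ∀ i, 0 ≤ t i) :
    ∃ D : Fin m → Fin n → ℝ, (∀ i j, 0 ≤ D i j) ∧ (∀ i, ∑ j, D i j ≤ 1) ∧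
      (∀ j, ∑ i, D i j ≤ 1) ∧
      ∑ i, t i ^ 2 + ∑ i, s i ^ 2 - 2 * ∑ i : Fin m, ∑ j : Fin n, D i j * (pad s i * pad t j) ≤
        ‖A * rectDiag t * Bᴴ - U * rectDiag s * Vᴴ‖ ^ 2 := by
  set P := Uᴴ * A with hPdef
  set Q := Vᴴ * B with hQdef
  have hP := unitary_conjTranspose_mul hU hA
  have hQ := unitary_conjTranspose_mul hV hB
  rw [← hPdef] at hP
  rw [← hQdef] at hQ
  set a : Fin m → Fin n → ℍ[ℝ] := fun i j => pad (P i) j with ha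
  set b : Fin m → Fin n → ℍ[ℝ] := fun i j => pad (fun k => Q k j) i with hb
  have haR : ∀ i, ∑ j, ‖a i j‖ ^ 2 ≤ 1 := fun i =>
    (sum_pad_norm_sq_le (P i) n).trans_eq (sum_row_norm_sq hP.2 i)
  have hbC : ∀ j, ∑ i, ‖b i j‖ ^ 2 ≤ 1 := fun j =>
    (sum_pad_norm_sq_le (fun k => Q k j) m).trans_eq (sum_col_norm_sq hQ.1 j)
  have haC : ∀ j : Fin n, (j : ℕ) < m → ∑ i, ‖a i j‖ ^ 2 = 1 := fun j hj => by
    simp only [ha, pad_of_lt _ hj, sum_col_norm_sq hP.1]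
  have hbR : ∀ i : Fin m, (i : ℕ) < n → ∑ j, ‖b i j‖ ^ 2 = 1 := fun i hi => by
    simp only [hb, pad_of_lt _ hi, sum_row_norm_sq hQ.2]
  have haC' : ∀ j, ∑ i, ‖a i j‖ ^ 2 ≤ 1 := fun j => by
    by_cases hj : (j : ℕ) < m
    · exact (haC j hj).le
    · simp [ha, pad_of_le _ (not_lt.1 hj)]
  have hbR' : ∀ i, ∑ j, ‖b i j‖ ^ 2 ≤ 1 := fun i => by
    by_cases hi : (i : ℕ) < n
    · exact (hbR i hi).le
    · simp [hb, pad_of_le _ (not_lt.1 hi)]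
  -- Truncation loses nothing here: a column of a without unit norm has j ≥ m, and there the padded
  -- t vanishes.
  have hta : ∑ i : Fin m, ∑ j : Fin n, pad t j ^ 2 * ‖a i j‖ ^ 2 = ∑ i, t i ^ 2 := by
    rw [Finset.sum_comm, ← sum_comp_pad t (g := fun x => x ^ 2) (by simp) (min_le_right m n)]
    refine Finset.sum_congr rfl fun j _ => ?_
    rw [← Finset.mul_sum]
    by_cases hj : (j : ℕ) < m
    · rw [haC j hj, mul_one]
    · rw [pad_of_le t (by omega)]
      simp
  have hsb : ∑ i : Fin m, ∑ j : Fin n, pad s i ^ 2 * ‖b i j‖ ^ 2 = ∑ i, s i ^ 2 := by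
    rw [← sum_comp_pad s (g := fun x => x ^ 2) (by simp) (min_le_left m n)]
    refine Finset.sum_congr rfl fun i _ => ?_
    rw [← Finset.mul_sum]
    by_cases hi : (i : ℕ) < n
    · rw [hbR i hi, mul_one]
    · rw [pad_of_le s (by omega)]
      simp
  refine ⟨fun i j => (‖a i j‖ ^ 2 + ‖b i j‖ ^ 2) / 2, fun i j => by positivity, fun i => ?_,
    fun j => ?_, ?_⟩
  · rw [← Finset.sum_div, Finset.sum_add_distrib]
    linarith [haR i, hbR' i]
  · rw [← Finset.sum_div, Finset.sum_add_distrib]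
    linarith [haC' j, hbC j]
  · rw [← frobenius_norm_sq_mul_left (U := Uᴴ) (by simpa using hU.2),
      ← frobenius_norm_sq_mul_right hB.2, conjTranspose_mul_sub_mul hU.1 hB.1,
      frobenius_norm_sq, ← hta, ← hsb]
    simp only [Finset.mul_sum, ← Finset.sum_add_distrib, ← Finset.sum_sub_distrib]
    refine Finset.sum_le_sum fun i _ => Finset.sum_le_sum fun j _ => ?_
    rw [Matrix.sub_apply, mul_rectDiag_apply, rectDiag_mul_apply]
    refine le_trans (le_of_eq ?_)
      (norm_sq_mul_coe_sub_le (pad_nonneg ht j) (pad_nonneg hs i))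
    simp only [ha, hb]
    ring

/-- The separable lower bound behind the optimality of singular value thresholding. -/
theorem sum_le_of_substochastic {ι κ : Type*} [Fintype ι] [Fintype κ] {D : ι → κ → ℝ}
    (hD : ∀ i j, 0 ≤ D i j) (hR : ∀ i, ∑ j, D i j ≤ 1) (hC : ∀ j, ∑ i, D i j ≤ 1)
    {h : ι → ℝ} {k : κ → ℝ} {w : ι → κ → ℝ} (hh : ∀ i, h i ≤ 0) (hk : ∀ j, 0 ≤ k j)
    (hw : ∀ i j, h i ≤ k j - w i j) :
    ∑ i, h i ≤ ∑ j, k j - ∑ i, ∑ j, D i j * w i j := by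
  -- Scaling a nonpositive number by a row sum at most 1 can only increase it; `h2` is the mirror
  -- image for k ≥ 0.
  have h1 : ∑ i, h i ≤ ∑ i, ∑ j, D i j * h i := Finset.sum_le_sum fun i _ => by
    rw [← Finset.sum_mul]
    nlinarith [hR i, hh i]
  have h2 : ∑ i, ∑ j, D i j * k j ≤ ∑ j, k j := by
    rw [Finset.sum_comm]
    refine Finset.sum_le_sum fun j _ => ?_
    rw [← Finset.sum_mul]
    nlinarith [hC j, hk j]
  have h3 : ∑ i, ∑ j, D i j * h i ≤ ∑ i, ∑ j, D i j * k j - ∑ i, ∑ j, D i j * w i j := by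
    simp only [← Finset.sum_sub_distrib]
    refine Finset.sum_le_sum fun i _ => Finset.sum_le_sum fun j _ => ?_
    rw [← mul_sub]
    exact mul_le_mul_of_nonneg_left (hw i j) (hD i j)
  linarith

end

end QuaternionMatrix

/-! ### Optimality of the thresholded matrix -/

theorem mainTheorem2 {m n : ℕ} (c η μ : ℝ) (hc : 0 < c) (hη : 0 < η) (hμ : 0 < μ)
    (Y : Matrix (Fin m) (Fin n) ℍ[ℝ]) (U : Matrix (Fin m) (Fin m) ℍ[ℝ])
    (s : Fin (min m n) → ℝ) (V : Matrix (Fin n) (Fin n) ℍ[ℝ])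
    (hY : QuaternionMatrix.IsQSVD Y U s V) :
    (∀ i, (QuaternionMatrix.prox (fun x => 1 / μ * QuaternionMatrix.mcp c η x) (s i)).Nonempty) ∧
    ∀ p : Fin (min m n) → ℝ,
      (∀ i, p i ∈ QuaternionMatrix.prox (fun x => 1 / μ * QuaternionMatrix.mcp c η x) (s i)) →
      IsMinOn
        (fun L : Matrix (Fin m) (Fin n) ℍ[ℝ] =>
          1 / μ * QuaternionMatrix.mcpNorm c η L + 1 / 2 * ‖L - Y‖ ^ 2)
        Set.univ (U * QuaternionMatrix.rectDiag p * Vᴴ) := by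
  have hf0 : ∀ x, 0 ≤ 1 / μ * QuaternionMatrix.mcp c η x := fun x =>
    mul_nonneg (by positivity) (QuaternionMatrix.mcp_nonneg hc hη x)
  refine ⟨fun i => QuaternionMatrix.prox_nonempty
    ((QuaternionMatrix.continuous_mcp hη).const_mul _) hf0 _, fun p hp L _ => ?_⟩
  obtain ⟨-, A, B, hL⟩ := QuaternionMatrix.singularValues_spec L
  set t := QuaternionMatrix.singularValues L with ht
  have hopt : ∀ i x, 1 / μ * QuaternionMatrix.mcp c η (p i) + 1 / 2 * (p i - s i) ^ 2 ≤
      1 / μ * QuaternionMatrix.mcp c η x + 1 / 2 * (x - s i) ^ 2 := fun i x => by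
    simpa using hp i (Set.mem_univ x)
  have hmcp0 := QuaternionMatrix.mcp_zero hc hη
  obtain ⟨D, hD, hR, hC, hle⟩ := QuaternionMatrix.exists_substochastic hY.left_unitary
    hY.right_unitary hL.left_unitary hL.right_unitary hY.nonneg hL.nonneg
  rw [← hL.eq, ← hY.eq] at hle
  -- Expanding the square shows that this is k(p_i) − s_i p_i, the least value of k(x) − s_i x;
  -- testing x = 0 makes it nonpositive.
  set h : Fin (min m n) → ℝ := fun i =>
    1 / μ * QuaternionMatrix.mcp c η (p i) + 1 / 2 * (p i - s i) ^ 2 - 1 / 2 * s i ^ 2 with hh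
  set k : ℝ → ℝ := fun x => 1 / μ * QuaternionMatrix.mcp c η x + 1 / 2 * x ^ 2 with hk
  have hk0 : ∀ x, 0 ≤ k x := fun x => add_nonneg (hf0 x) (by positivity)
  have hkh : ∀ i x, h i ≤ k x - s i * x := fun i x => by
    simp only [hh, hk]
    linarith [hopt i x]
  have hh0 : ∀ i, h i ≤ 0 := fun i => by
    simpa [hk, hmcp0] using hkh i 0
  have hsum := QuaternionMatrix.sum_le_of_substochastic hD hR hC
    (h := fun i => QuaternionMatrix.pad h i) (k := fun j => k (QuaternionMatrix.pad t j))
    (w := fun i j => QuaternionMatrix.pad s i * QuaternionMatrix.pad t j)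
    (fun i => by
      unfold QuaternionMatrix.pad
      split_ifs
      exacts [hh0 _, le_rfl])
    (fun j => hk0 _)
    (fun i j => by
      by_cases hi : (i : ℕ) < min m n
      · rw [QuaternionMatrix.pad_of_lt h hi, QuaternionMatrix.pad_of_lt s hi]
        exact hkh _ _
      -- For padded rows h and s are both 0, and the inequality reduces to k ≥ 0.
      · rw [QuaternionMatrix.pad_of_le h (not_lt.1 hi), QuaternionMatrix.pad_of_le s (not_lt.1 hi),
          zero_mul, sub_zero]
        exact hk0 _)
  rw [QuaternionMatrix.sum_comp_pad h (g := fun x => x) rfl (min_le_left m n),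
    QuaternionMatrix.sum_comp_pad t (g := k) (by simp [hk, hmcp0]) (min_le_right m n)] at hsum
  have hval : ‖U * QuaternionMatrix.rectDiag p * Vᴴ - Y‖ ^ 2 = ∑ i, (p i - s i) ^ 2 := by
    have h1 : U * QuaternionMatrix.rectDiag p * Vᴴ - Y =
        U * QuaternionMatrix.rectDiag (fun i => p i - s i) * Vᴴ := by
      rw [hY.eq, ← Matrix.sub_mul, ← Matrix.mul_sub]
      congr 2
      ext1 i j
      simp only [QuaternionMatrix.rectDiag, Matrix.sub_apply, Matrix.of_apply]
      split_ifs <;> simp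
    rw [h1, QuaternionMatrix.frobenius_norm_sq_mul_right (by simpa using hY.right_unitary.1),
      QuaternionMatrix.frobenius_norm_sq_mul_left hY.left_unitary.1,
      QuaternionMatrix.frobenius_norm_sq_rectDiag]
  change 1 / μ * QuaternionMatrix.mcpNorm c η (U * QuaternionMatrix.rectDiag p * Vᴴ) +
    1 / 2 * ‖U * QuaternionMatrix.rectDiag p * Vᴴ - Y‖ ^ 2 ≤
    1 / μ * QuaternionMatrix.mcpNorm c η L + 1 / 2 * ‖L - Y‖ ^ 2
  rw [QuaternionMatrix.mcpNorm_mul_rectDiag_mul hc hη hY.left_unitary hY.right_unitary, hval,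
    QuaternionMatrix.mcpNorm, ← ht]
  simp only [hh, hk, Finset.sum_add_distrib, Finset.sum_sub_distrib, ← Finset.mul_sum] at hsum
  linarith
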